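/- Let $K$ be a field that is complete for a non-Archimedean absolute value $|\cdot|$. Let $N$ be a lattice (a free $\mathbb{Z}$-module of finite rank) with dual lattice $M=\mathrm{Hom}(N,\mathbb{Z})$, let $\sigma\subset N_{\mathbb{R}}=N\otimes_{\mathbb{Z}}\mathbb{R}$ be a strongly convex rational polyhedral cone (generated by finitely many vectors of $N$ and containing no line through the origin), let $\sigma^{\vee}=\{u\in N_{\mathbb{R}}^{*}:\langle u,v\rangle\ge 0\ \text{for all } v\in\sigma\}$ and $S_\sigma=\sigma^{\vee}\cap M$. Let $K\langle S_\sigma\rangle$ be the completion of the semigroup algebra $K[S_\sigma]$ for the Gauss norm $\bigl|\sum_u a_u\chi^u\bigr|=\max_u|a_u|$. Then every $f\in K\langle S_\sigma\rangle$ can be written uniquely as a convergent sum $f=\sum_{u\in S_\sigma}a_u\chi^u$ with $a_u\in K$ and $a_u\to 0$ (that is, for every $\varepsilon>0$ one has $|a_u|<\varepsilon$ for all but finitely many $u$), and $$|f|_{\sup}:=\sup_{x\in \mathrm{Max}\,K\langle S_\sigma\rangle}|f(x)|=\max_{u\in S_\sigma}|a_u| .$$ In particular the supremum is finite and the maximum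 is attained. Here $\mathrm{Max}\,A$ is the set of maximal ideals of $A$, and $|f(x)|$ is the absolute value of the class of $f$ in the residue field $A/x$ for the unique extension of $|\cdot|$ from $K$ to that field. -/

import Mathlib

open Filter Topology TensorProduct

noncomputable section

namespace ToricRigid

/-! ### Cones and their semigroups -/

section Cones

variable {N : Type*} [AddCommGroup N]

/-- A cone in `N_ℝ = ℝ ⊗ N` is a strongly convex rational polyhedral cone if it is generated by
finitely many vectors of the lattice `N` and contains no line through the origin. -/
structure IsStronglyConvexRationalPolyhedral (σ : PointedCone ℝ (ℝ ⊗[ℤ] N)) : Prop where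
  rational_polyhedral : ∃ s : Finset N,
    σ = PointedCone.hull ℝ ((fun v : N => (1 : ℝ) ⊗ₜ[ℤ] v) '' (s : Set N))
  strongly_convex : ∀ v ∈ σ, -v ∈ σ → v = 0

/-- The dual cone `σ^∨ = {u ∈ (N_ℝ)^* : ⟨u, v⟩ ≥ 0 for all v ∈ σ}`. -/
def dualCone (σ : PointedCone ℝ (ℝ ⊗[ℤ] N)) : PointedCone ℝ (Module.Dual ℝ (ℝ ⊗[ℤ] N)) :=
  PointedCone.dual (Module.Dual.eval ℝ (ℝ ⊗[ℤ] N)) (σ : Set (ℝ ⊗[ℤ] N))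

/-- The semigroup `S_σ = σ^∨ ∩ M`, where the dual lattice `M = Hom(N, ℤ)` is mapped to `(N_ℝ)^*` by
extension of scalars. -/
def semigroup (σ : PointedCone ℝ (ℝ ⊗[ℤ] N)) : AddSubmonoid (Module.Dual ℤ N) where
  carrier := {u | Module.Dual.baseChange ℝ u ∈ dualCone σ}
  zero_mem' := by simp
  add_mem' {u v} hu hv := by
    simp only [Set.mem_ofPred_eq, map_add] at *
    exact add_mem hu hv

end Cones

/-! ### The Gauss norm on a semigroup algebra and its completion -/

section Algebra

variable {K : Type*} [NormedField K] {S : Type*}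

/-- The Gauss norm `max_u |a_u|` of a finite sum `∑ a_u χ^u`. -/
def gaussNNNorm (f : AddMonoidAlgebra K S) : NNReal :=
  f.coeff.support.sup fun u => ‖f.coeff u‖₊

theorem nnnorm_coeff_le (f : AddMonoidAlgebra K S) (u : S) : ‖f.coeff u‖₊ ≤ gaussNNNorm f := by
  by_cases h : u ∈ f.coeff.support
  · exact Finset.le_sup (f := fun u => ‖f.coeff u‖₊) h
  · simp [Finsupp.notMem_support_iff.mp h]

theorem gaussNNNorm_le {f : AddMonoidAlgebra K S} {c : NNReal} (h : ∀ u, ‖f.coeff u‖₊ ≤ c) :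
    gaussNNNorm f ≤ c :=
  Finset.sup_le fun u _ => h u

theorem gaussNNNorm_add_le (f g : AddMonoidAlgebra K S) :
    gaussNNNorm (f + g) ≤ gaussNNNorm f + gaussNNNorm g :=
  gaussNNNorm_le fun u => by
    rw [AddMonoidAlgebra.coeff_add, Finsupp.add_apply]
    exact (nnnorm_add_le _ _).trans (add_le_add (nnnorm_coeff_le f u) (nnnorm_coeff_le g u))

variable [IsUltrametricDist K] [AddCommMonoid S]

theorem gaussNNNorm_mul_le (f g : AddMonoidAlgebra K S) :
    gaussNNNorm (f * g) ≤ gaussNNNorm f * gaussNNNorm g := by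
  classical
  refine gaussNNNorm_le fun u => ?_
  rw [AddMonoidAlgebra.coeff_mul, Finsupp.sum]
  refine IsUltrametricDist.nnnorm_sum_le_of_forall_le fun i _ => ?_
  refine IsUltrametricDist.nnnorm_sum_le_of_forall_le fun j _ => ?_
  dsimp only
  split_ifs
  · rw [nnnorm_mul]
    exact mul_le_mul' (nnnorm_coeff_le f i) (nnnorm_coeff_le g j)
  · simp

/-- The Gauss norm as an additive group norm on `K[S]`. -/
def gaussNorm : AddGroupNorm (AddMonoidAlgebra K S) where
  toFun f := (gaussNNNorm f : ℝ)
  map_zero' := by simp [gaussNNNorm]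
  add_le' f g := by exact_mod_cast gaussNNNorm_add_le f g
  neg' f := by simp [gaussNNNorm]
  eq_zero_of_map_eq_zero' f hf := by
    ext u
    have h := nnnorm_coeff_le f u
    rw [NNReal.coe_eq_zero.mp hf] at h
    simpa using h

/-- The semigroup algebra `K[S]` normed by the Gauss norm. -/
instance gaussNormedCommRing : NormedCommRing (AddMonoidAlgebra K S) where
  __ := (gaussNorm : AddGroupNorm (AddMonoidAlgebra K S)).toNormedAddCommGroup
  __ := (inferInstance : CommRing (AddMonoidAlgebra K S))
  norm_mul_le f g := by exact_mod_cast gaussNNNorm_mul_le f g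

instance gaussNormedAlgebra : NormedAlgebra K (AddMonoidAlgebra K S) where
  norm_smul_le c f := by
    have h : gaussNNNorm (c • f) ≤ ‖c‖₊ * gaussNNNorm f := gaussNNNorm_le fun u => by
      rw [AddMonoidAlgebra.coeff_smul, Finsupp.smul_apply, nnnorm_smul]
      exact mul_le_mul' le_rfl (nnnorm_coeff_le f u)
    exact_mod_cast h

variable (K S) in
/-- The algebra `K⟨S⟩`: the completion of the semigroup algebra `K[S]` for the Gauss norm. If `K`
has mixed characteristic `(0, p)` and ring of integers `R`, this is the `p`-adic completion of
`R[S]` with `p` inverted, because the closed unit ball of `K[S]` is `R[S]`. -/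
abbrev ConvergentAlgebra : Type _ := UniformSpace.Completion (AddMonoidAlgebra K S)

variable (K) in
/-- The monomial `χ^u` in `K⟨S⟩`. -/
def chi (u : S) : ConvergentAlgebra K S :=
  ((AddMonoidAlgebra.single u 1 : AddMonoidAlgebra K S) : ConvergentAlgebra K S)

/-- `f = ∑_u a_u χ^u` in `K⟨S⟩`, with `a_u ∈ K` and `a_u → 0`. -/
structure IsExpansion (a : S → K) (f : ConvergentAlgebra K S) : Prop where
  tendsto_zero : Tendsto a cofinite (𝓝 0)
  hasSum : HasSum (fun u => a u • chi K u) f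

end Algebra

/-! ### The supremum seminorm -/

section Sup

variable (K : Type*) [NormedField K] {A : Type*} [CommRing A] [Algebra K A]

/-- The value `|f(x)|` at a point `x` of `Max A`: the absolute value of the class `f(x)` of `f` in
the residue field `A / x` (an algebraic extension of `K` when `A` is affinoid), for the unique
extension of the absolute value of `K`. -/
def absAt (f : A) (x : MaximalSpectrum A) : ℝ :=
  letI : Field (A ⧸ x.asIdeal) := Ideal.Quotient.field x.asIdeal
  spectralNorm K (A ⧸ x.asIdeal) (Ideal.Quotient.mk x.asIdeal f)

/-- The supremum seminorm `|f|_sup = sup_{x ∈ Max A} |f(x)|`. -/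
def supSeminorm (f : A) : ℝ := ⨆ x : MaximalSpectrum A, absAt K f x

end Sup

end ToricRigid

end

noncomputable section

namespace ToricRigid

/-! Coefficients extend continuously from `K[S]` to the completion; density gives the expansion and
shows that `‖f‖` is the largest `|a_u|`. It remains to find `max_x |f(x)| = ‖f‖`.

Upper bound (`absAt_le_norm`): if `|f(x)| > ‖f‖` and `P` is the minimal polynomial of `f(x)`, the
constant term of `P` dominates in `P(f)`, so `P(f)` is a unit; yet it lies in `x`.

Lower bound (`exists_norm_le_absAt`): for `g` in `K[S]` with largest coefficient at `u₀`, choose `v`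
in `N` and a prime `m` with `|m| = 1` such that `u ↦ u(v) mod m` separates `u₀` from the rest of the
support. Fourier inversion on `ℤ/m` bounds the coefficient by the value of `g` at some character,
which is a point with algebraic residue field. Approximating `f` by `g` finishes the proof. -/

/-- In an ultrametric group, elements whose difference is smaller than the first have equal norm. -/
theorem norm_eq_of_norm_sub_lt_left {E : Type*} [SeminormedAddCommGroup E] [IsUltrametricDist E]
    {x y : E} (h : ‖x - y‖ < ‖x‖) : ‖x‖ = ‖y‖ := by
  rw [← norm_neg y]
  exact IsUltrametricDist.norm_eq_of_add_norm_lt_max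
    (by rw [← sub_eq_add_neg]; exact lt_max_of_lt_left h)

/-! ### Coefficients and the Gauss norm on the completion. -/

section Completion

variable {K : Type*} [NormedField K] [IsUltrametricDist K] {S : Type*} [AddCommMonoid S]

theorem norm_eq_gaussNNNorm (f : AddMonoidAlgebra K S) : ‖f‖ = gaussNNNorm f := rfl

theorem norm_coeff_le (f : AddMonoidAlgebra K S) (u : S) : ‖f.coeff u‖ ≤ ‖f‖ :=
  nnnorm_coeff_le f u

theorem norm_le_of_forall_coeff {f : AddMonoidAlgebra K S} {c : ℝ} (hc : 0 ≤ c)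
    (h : ∀ u, ‖f.coeff u‖ ≤ c) : ‖f‖ ≤ c := by
  lift c to NNReal using hc
  exact gaussNNNorm_le (c := c) h

theorem exists_norm_coeff_eq (f : AddMonoidAlgebra K S) : ∃ u, ‖f.coeff u‖ = ‖f‖ := by
  rcases f.coeff.support.eq_empty_or_nonempty with h | h
  · refine ⟨0, ?_⟩
    rw [norm_eq_gaussNNNorm, gaussNNNorm, h]
    simp [Finsupp.support_eq_empty.mp h]
  · obtain ⟨u, -, hu⟩ := Finset.exists_mem_eq_sup _ h fun u => ‖f.coeff u‖₊
    exact ⟨u, congrArg NNReal.toReal hu.symm⟩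

instance : IsUltrametricDist (AddMonoidAlgebra K S) :=
  IsUltrametricDist.isUltrametricDist_of_forall_norm_add_le_max_norm fun f g =>
    norm_le_of_forall_coeff (le_max_of_le_left (norm_nonneg f)) fun u =>
      (IsUltrametricDist.norm_add_le_max (f.coeff u) (g.coeff u)).trans
        (max_le_max (norm_coeff_le f u) (norm_coeff_le g u))

instance : IsUltrametricDist (ConvergentAlgebra K S) :=
  IsUltrametricDist.isUltrametricDist_of_forall_norm_add_le_max_norm fun f g => by
    refine UniformSpace.Completion.induction_on₂ f g
      (isClosed_le (by fun_prop) (by fun_prop)) fun f g => ?_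
    rw [← UniformSpace.Completion.coe_add]
    simpa only [UniformSpace.Completion.norm_coe] using IsUltrametricDist.norm_add_le_max f g

/-- The semigroup algebra is dense in its completion. -/
theorem exists_norm_sub_coe_lt (f : ConvergentAlgebra K S) {ε : ℝ} (hε : 0 < ε) :
    ∃ g : AddMonoidAlgebra K S, ‖f - (g : ConvergentAlgebra K S)‖ < ε := by
  obtain ⟨-, h, g, rfl⟩ := Metric.dense_iff.mp
    (UniformSpace.Completion.denseRange_coe (α := AddMonoidAlgebra K S)) f ε hε
  exact ⟨g, by rwa [Metric.mem_ball, dist_comm, dist_eq_norm] at h⟩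

theorem norm_sum_smul_chi_le (T : Finset S) (a : S → K) {c : ℝ} (hc : 0 ≤ c)
    (h : ∀ u, ‖a u‖ ≤ c) : ‖∑ u ∈ T, a u • chi K u‖ ≤ c := by
  refine IsUltrametricDist.norm_sum_le_of_forall_le_of_nonneg hc fun u _ => ?_
  rw [chi, ← UniformSpace.Completion.coe_smul, UniformSpace.Completion.norm_coe]
  refine norm_le_of_forall_coeff hc fun v => ?_
  classical
  rw [AddMonoidAlgebra.coeff_smul, AddMonoidAlgebra.coeff_single, Finsupp.smul_apply,
    Finsupp.single_apply]
  split_ifs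
  · simpa using h u
  · simpa using hc

theorem coe_eq_sum_smul_chi (g : AddMonoidAlgebra K S) {T : Finset S}
    (hT : g.coeff.support ⊆ T) :
    (g : ConvergentAlgebra K S) = ∑ u ∈ T, g.coeff u • chi K u := by
  have : g = ∑ u ∈ T, g.coeff u • AddMonoidAlgebra.single u (1 : K) := by
    ext v
    classical
    simp only [AddMonoidAlgebra.coeff_sum, AddMonoidAlgebra.coeff_smul,
      AddMonoidAlgebra.coeff_single, Finsupp.finsetSum_apply, Finsupp.smul_apply,
      Finsupp.single_apply, smul_eq_mul, mul_ite, mul_one, mul_zero, Finset.sum_ite_eq']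
    split_ifs with h
    · rfl
    · exact Finsupp.notMem_support_iff.mp fun h' => h (hT h')
  conv_lhs => rw [this]
  change UniformSpace.Completion.toComplL (𝕜 := K) _ = _
  rw [map_sum]
  simp only [map_smul]
  rfl

variable [CompleteSpace K]

variable (K) in
/-- The coefficient of `χ^u` in an element of `K⟨S⟩`. -/
def coeffL (u : S) : ConvergentAlgebra K S →L[K] K :=
  (LinearMap.mkContinuous
    { toFun := fun f : AddMonoidAlgebra K S => f.coeff u
      map_add' := fun _ _ => rfl
      map_smul' := fun _ _ => rfl } 1
    fun f => (norm_coeff_le f u).trans (one_mul _).ge).extend UniformSpace.Completion.toComplL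

theorem coeffL_coe (u : S) (g : AddMonoidAlgebra K S) :
    coeffL K u (g : ConvergentAlgebra K S) = g.coeff u :=
  ContinuousLinearMap.extend_eq _ UniformSpace.Completion.denseRange_coe
    (UniformSpace.Completion.isUniformInducing_coe _) g

theorem norm_coeffL_le (u : S) (f : ConvergentAlgebra K S) : ‖coeffL K u f‖ ≤ ‖f‖ := by
  refine UniformSpace.Completion.induction_on f
    (isClosed_le (by fun_prop) (by fun_prop)) fun g => ?_
  rw [coeffL_coe, UniformSpace.Completion.norm_coe]
  exact norm_coeff_le g u

theorem coeffL_chi [DecidableEq S] (u v : S) :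
    coeffL K u (chi K v) = if v = u then 1 else 0 := by
  rw [chi, coeffL_coe, AddMonoidAlgebra.coeff_single, Finsupp.single_apply]

/-- For `g` in `K[S]` close to `f`, the coefficients of `f` off the support of `g` are those of `f -
g`, and partial sums over sets containing that support differ from `f` by terms controlled by `‖f -
g‖`. -/
theorem isExpansion_coeffL (f : ConvergentAlgebra K S) :
    IsExpansion (fun u => coeffL K u f) f where
  tendsto_zero := by
    rw [Metric.tendsto_nhds]
    intro ε hε
    obtain ⟨g, hg⟩ := exists_norm_sub_coe_lt f hε
    refine g.coeff.support.finite_toSet.subset fun u hu => ?_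
    by_contra h
    refine hu ?_
    have h0 : g.coeff u = 0 := Finsupp.notMem_support_iff.mp h
    have := norm_coeffL_le u (f - (g : ConvergentAlgebra K S))
    rw [map_sub, coeffL_coe, h0, sub_zero] at this
    change dist (coeffL K u f) 0 < ε
    rw [dist_zero_right]
    exact this.trans_lt hg
  hasSum := by
    rw [HasSum, SummationFilter.unconditional_filter, Metric.tendsto_nhds]
    intro ε hε
    obtain ⟨g, hg⟩ := exists_norm_sub_coe_lt f hε
    filter_upwards [eventually_ge_atTop g.coeff.support] with T hT
    have h : ∑ u ∈ T, coeffL K u f • chi K u - f =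
        ∑ u ∈ T, coeffL K u (f - (g : ConvergentAlgebra K S)) • chi K u + -(f - (g : ConvergentAlgebra K S)) := by
      simp only [map_sub, coeffL_coe, sub_smul, Finset.sum_sub_distrib,
        ← coe_eq_sum_smul_chi g hT]
      abel
    rw [dist_eq_norm, h]
    refine (IsUltrametricDist.norm_add_le_max _ _).trans_lt ?_
    rw [norm_neg]
    exact max_lt ((norm_sum_smul_chi_le T _ (norm_nonneg _)
      fun u => norm_coeffL_le u _).trans_lt hg) hg

theorem IsExpansion.eq_coeffL {a : S → K} {f : ConvergentAlgebra K S} (h : IsExpansion a f) :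
    a = fun u => coeffL K u f := by
  classical
  ext u
  have h1 := (coeffL K u).hasSum h.hasSum
  simp only [map_smul, coeffL_chi, smul_eq_mul, mul_ite, mul_one, mul_zero] at h1
  have h2 : (fun b => if b = u then a b else 0) = fun b => if b = u then a u else 0 := by
    ext b
    split_ifs with hb
    · rw [hb]
    · rfl
  rw [h2] at h1
  exact (hasSum_ite_eq u (a u)).unique h1

theorem existsUnique_isExpansion (f : ConvergentAlgebra K S) : ∃! a : S → K, IsExpansion a f :=
  ⟨_, isExpansion_coeffL f, fun _ h => h.eq_coeffL⟩

/-- If `‖f - g‖ < ‖f‖`, a largest coefficient of `g` keeps its absolute value in `f`. -/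
theorem isGreatest_norm_coeffL (f : ConvergentAlgebra K S) :
    IsGreatest (Set.range fun u : S => ‖coeffL K u f‖) ‖f‖ := by
  refine ⟨?_, by rintro - ⟨u, rfl⟩; exact norm_coeffL_le u f⟩
  rcases eq_or_ne f 0 with rfl | hf
  · exact ⟨0, by simp⟩
  obtain ⟨g, hg⟩ := exists_norm_sub_coe_lt f (norm_pos_iff.mpr hf)
  obtain ⟨u, hu⟩ := exists_norm_coeff_eq g
  have hfg : ‖f‖ = ‖(g : ConvergentAlgebra K S)‖ := norm_eq_of_norm_sub_lt_left hg
  rw [UniformSpace.Completion.norm_coe] at hfg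
  refine ⟨u, ?_⟩
  have h1 := (norm_coeffL_le u (f - (g : ConvergentAlgebra K S))).trans_lt hg
  rw [map_sub, coeffL_coe, hfg, ← hu] at h1
  change ‖coeffL K u f‖ = ‖f‖
  rw [hfg, ← hu]
  exact (norm_eq_of_norm_sub_lt_left (by rwa [norm_sub_rev])).symm

end Completion

/-! ### Upper bound: spectral values and units. -/

section SpectralValue

open Polynomial

variable {K : Type*} [NormedField K]

theorem norm_coeff_le_spectralValue_pow (P : K[X]) {i : ℕ} (hi : i < P.natDegree) :
    ‖P.coeff i‖ ≤ spectralValue P ^ (P.natDegree - i) := by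
  have h : spectralValueTerms P i ≤ spectralValue P :=
    le_ciSup (spectralValueTerms_bddAbove P) i
  rw [spectralValueTerms_of_lt_natDegree P hi, ← Nat.cast_sub hi.le, one_div] at h
  rw [← Real.rpow_inv_natCast_pow (norm_nonneg (P.coeff i)) (Nat.sub_ne_zero_of_lt hi)]
  exact pow_le_pow_left₀ (Real.rpow_nonneg (norm_nonneg _) _) h _

variable [IsUltrametricDist K] [CompleteSpace K]

/-- Over a complete non-Archimedean field the roots of an irreducible polynomial all have the same
absolute value, which is therefore determined by the constant coefficient. -/
theorem spectralValue_pow_natDegree_le {P : K[X]} (hP : Irreducible P) (hm : P.Monic) :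
    spectralValue P ^ P.natDegree ≤ ‖P.coeff 0‖ := by
  have hn : P.natDegree ≠ 0 := hP.natDegree_pos.ne'
  by_cases hK : ∃ c : K, 1 < ‖c‖
  · let : NontriviallyNormedField K := { ‹NormedField K› with non_trivial := hK }
    obtain ⟨z, hz⟩ := IsAlgClosed.exists_aeval_eq_zero (AlgebraicClosure K) P
      (by rw [degree_eq_natDegree hm.ne_zero]; exact_mod_cast hn)
    have h := spectralNorm.spectralNorm_eq_norm_coeff_zero_rpow K (AlgebraicClosure K) z
    rw [spectralNorm, ← minpoly.eq_of_irreducible_of_monic hP hz hm] at h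
    rw [h, one_div, Real.rpow_inv_natCast_pow (norm_nonneg _) hn]
  -- Trivial absolute value: either `P = X`, with spectral value 0, or `|P(0)| = 1` and all
  -- coefficients are at most 1.
  · push Not at hK
    rcases eq_or_ne (P.coeff 0) 0 with h0 | h0
    · have hX : P = X := (eq_of_monic_of_associated monic_X hm
        (irreducible_X.associated_of_dvd hP (X_dvd_iff.mpr h0))).symm
      rw [hX]
      have := spectralValue_X_pow (R := K) 1
      rw [pow_one] at this
      simp [this]
    · have h1 : ‖P.coeff 0‖ = 1 := by
        refine le_antisymm (hK _) ?_
        have := hK (P.coeff 0)⁻¹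
        rw [norm_inv] at this
        exact (inv_le_one₀ (norm_pos_iff.mpr h0)).mp this
      rw [h1]
      exact pow_le_one₀ (spectralValue_nonneg P)
        ((spectralValue_le_one_iff hm).mpr fun n => hK _)

/-- In a complete ultrametric `K`-algebra, an irreducible polynomial takes a unit value at every
element of norm less than the absolute value of its roots. -/
theorem isUnit_aeval_of_norm_lt_spectralValue {A : Type*} [NormedCommRing A] [CompleteSpace A]
    [IsUltrametricDist A] [NormedAlgebra K A] {P : K[X]} (hP : Irreducible P) (hm : P.Monic)
    {f : A} (hf : ‖f‖ < spectralValue P) : IsUnit (aeval f P) := by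
  set r := spectralValue P
  have hr : 0 < r := (norm_nonneg f).trans_lt hf
  have hn : 0 < P.natDegree := hP.natDegree_pos
  have hr0 : r ^ P.natDegree ≤ ‖P.coeff 0‖ := spectralValue_pow_natDegree_le hP hm
  have h0 : P.coeff 0 ≠ 0 := norm_pos_iff.mp ((pow_pos hr _).trans_le hr0)
  -- With `n` the degree, `|a_i| ≤ r ^ (n - i)`, `‖f‖ < r` and `r ^ n ≤ |a_0|` make the sum smaller
  -- than 1, so the geometric series inverts the bracket.
  have key : aeval f P = algebraMap K A (P.coeff 0) *
      (1 - -∑ i ∈ Finset.range P.natDegree,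
        ((P.coeff 0)⁻¹ * P.coeff (i + 1)) • f ^ (i + 1)) := by
    rw [aeval_eq_sum_range, Finset.sum_range_succ', sub_neg_eq_add, mul_add, mul_one, pow_zero,
      Algebra.algebraMap_eq_smul_one, add_comm, smul_mul_assoc, one_mul, Finset.smul_sum]
    simp only [smul_smul, mul_inv_cancel_left₀ h0]
  rw [key]
  refine ((isUnit_iff_ne_zero.mpr h0).map (algebraMap K A)).mul (isUnit_one_sub_of_norm_lt_one ?_)
  rw [norm_neg]
  obtain ⟨i, hi, hle⟩ := IsUltrametricDist.exists_norm_finsetSum_le_of_nonempty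
    (Finset.nonempty_range_iff.mpr hn.ne')
    fun i => ((P.coeff 0)⁻¹ * P.coeff (i + 1)) • f ^ (i + 1)
  refine hle.trans_lt ?_
  have hi' : i + 1 ≤ P.natDegree := Finset.mem_range.mp hi
  have hc : ‖P.coeff (i + 1)‖ ≤ r ^ (P.natDegree - (i + 1)) := by
    rcases hi'.lt_or_eq with h | h
    · exact norm_coeff_le_spectralValue_pow P h
    · rw [h, hm.coeff_natDegree]; simp
  rw [norm_smul, norm_mul, norm_inv, mul_assoc, inv_mul_lt_iff₀ (norm_pos_iff.mpr h0), mul_one]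
  calc ‖P.coeff (i + 1)‖ * ‖f ^ (i + 1)‖
      ≤ r ^ (P.natDegree - (i + 1)) * ‖f‖ ^ (i + 1) :=
        mul_le_mul hc (norm_pow_le' f i.succ_pos) (norm_nonneg _) (by positivity)
    _ < r ^ (P.natDegree - (i + 1)) * r ^ (i + 1) :=
        mul_lt_mul_of_pos_left (pow_lt_pow_left₀ hf (norm_nonneg f) i.succ_ne_zero) (by positivity)
    _ = r ^ P.natDegree := by rw [← pow_add, Nat.sub_add_cancel hi']
    _ ≤ ‖P.coeff 0‖ := hr0

theorem absAt_le_norm {A : Type*} [NormedCommRing A] [CompleteSpace A] [IsUltrametricDist A]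
    [NormedAlgebra K A] (f : A) (x : MaximalSpectrum A) : absAt K f x ≤ ‖f‖ := by
  let : Field (A ⧸ x.asIdeal) := Ideal.Quotient.field x.asIdeal
  change spectralValue (minpoly K (Ideal.Quotient.mk x.asIdeal f)) ≤ ‖f‖
  set y := Ideal.Quotient.mk x.asIdeal f with hy
  by_cases hint : IsIntegral K y
  · by_contra! h
    have hu := isUnit_aeval_of_norm_lt_spectralValue (minpoly.irreducible hint)
      (minpoly.monic hint) h
    refine x.isMaximal.ne_top (Ideal.eq_top_of_isUnit_mem _ ?_ hu)
    rw [← Ideal.Quotient.eq_zero_iff_mem, ← Ideal.Quotient.mkₐ_eq_mk K, ← aeval_algHom_apply]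
    exact minpoly.aeval K y
  · rw [minpoly.eq_zero hint, spectralValue]
    refine ciSup_le fun n => ?_
    rw [spectralValueTerms_of_natDegree_le _ (by simp)]
    exact norm_nonneg f

end SpectralValue

/-! ### Separating exponents by a lattice vector. -/

/-- Finitely many nonzero integral functionals are simultaneously nonzero at some vector. -/
theorem exists_forall_apply_ne_zero {N : Type*} [AddCommGroup N] (T : Finset (Module.Dual ℤ N))
    (hT : 0 ∉ T) : ∃ v : N, ∀ w ∈ T, w v ≠ 0 := by
  by_contra! h
  -- Otherwise finitely many kernels cover `N`, so by B. H. Neumann one has finite index; as `ℤ` is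
  -- torsion-free, that functional is 0.
  obtain ⟨w, hw, hfin⟩ := AddSubgroup.exists_finiteIndex_of_leftCoset_cover
    (H := fun w : Module.Dual ℤ N => w.toAddMonoidHom.ker) (g := fun _ => 0) (s := T) <| by
      refine Set.eq_univ_of_forall fun v => ?_
      obtain ⟨w, hw, hv⟩ := h v
      exact Set.mem_iUnion₂.mpr ⟨w, hw, v, hv, zero_add v⟩
  have hw0 : w = 0 := by
    ext v
    have h1 : w (w.toAddMonoidHom.ker.index • v) = 0 :=
      w.toAddMonoidHom.ker.nsmul_index_mem v
    rw [map_nsmul, nsmul_eq_mul] at h1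
    exact (mul_eq_zero.mp h1).resolve_left (by exact_mod_cast hfin.index_ne_zero)
  exact hT (hw0 ▸ hw)

/-! ### Fourier inversion on `ℤ/m` with `|m| = 1`. -/

section FourierInversion

/-- At most one prime number has absolute value less than one in a non-Archimedean field. -/
theorem exists_prime_norm_eq_one (K : Type*) [NormedField K] [IsUltrametricDist K] (B : ℕ) :
    ∃ p : ℕ, p.Prime ∧ B < p ∧ ‖(p : K)‖ = 1 := by
  obtain ⟨p, hpB, hp⟩ := Nat.exists_infinite_primes (B + 1)
  obtain ⟨q, hqp, hq⟩ := Nat.exists_infinite_primes (p + 1)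
  have hle (n : ℕ) : ‖(n : K)‖ ≤ 1 := IsUltrametricDist.norm_natCast_le_one K n
  by_cases h1 : ‖(p : K)‖ = 1
  · exact ⟨p, hp, by lia, h1⟩
  refine ⟨q, hq, by lia, ?_⟩
  by_contra h2
  have hcop : Nat.Coprime p q := (Nat.coprime_primes hp hq).mpr (by lia)
  -- Bézout: if both primes had absolute value below 1, so would 1.
  have hb : (1 : K) = (p : K) * (Nat.gcdA p q : ℤ) + (q : K) * (Nat.gcdB p q : ℤ) := by
    have := congrArg (Int.cast : ℤ → K) (Nat.gcd_eq_gcd_ab p q)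
    rw [hcop.gcd_eq_one] at this
    push_cast at this
    exact this
  have hlt {n : ℕ} (hn : ¬ ‖(n : K)‖ = 1) (c : ℤ) : ‖(n : K) * c‖ < 1 := by
    rw [norm_mul]
    exact (mul_le_of_le_one_right (norm_nonneg _)
      (IsUltrametricDist.norm_intCast_le_one K c)).trans_lt ((hle n).lt_of_ne hn)
  have := (IsUltrametricDist.norm_add_le_max _ _).trans_lt
    (max_lt (hlt h1 (Nat.gcdA p q)) (hlt h2 (Nat.gcdB p q)))
  rw [← hb, norm_one] at this
  exact lt_irrefl _ this

variable {K : Type*} [NormedField K] {L : Type*} [Field L] [Algebra K L]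

/-- The evaluation of the group algebra `K[G]` at a character of `G`. -/
def evalAddChar (K : Type*) [Field K] {L G : Type*} [Field L] [Algebra K L] [AddCommGroup G]
    (θ : AddChar G L) : AddMonoidAlgebra K G →ₐ[K] L :=
  AddMonoidAlgebra.lift K L G θ.toMonoidHom

theorem evalAddChar_apply {G : Type*} [AddCommGroup G] [Fintype G] (θ : AddChar G L)
    (b : AddMonoidAlgebra K G) : evalAddChar K θ b = ∑ c, b.coeff c • θ c := by
  rw [evalAddChar, AddMonoidAlgebra.lift_apply, Finsupp.sum_fintype _ _ (by simp)]
  rfl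

variable [IsUltrametricDist K]

theorem spectralNorm_eq_one_of_pow_eq_one [Algebra.IsAlgebraic K L] {z : L} {n : ℕ} (hn : 0 < n)
    (hz : z ^ n = 1) : spectralNorm K L z = 1 := by
  have h := isPowMul_spectralNorm (K := K) z hn
  rw [hz, spectralNorm_one] at h
  exact (pow_eq_one_iff_of_nonneg (spectralNorm_nonneg z) hn.ne').mp h.symm

/-- Fourier inversion on `ℤ/mℤ` bounds the coefficients of an element of the group algebra by its
values at the characters. -/
theorem exists_norm_coeff_le_spectralNorm_evalAddChar [Algebra.IsAlgebraic K L] {m : ℕ} [NeZero m]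
    (hm : ‖(m : K)‖ = 1) {θ : AddChar (ZMod m) L} (hθ : θ.IsPrimitive)
    (b : AddMonoidAlgebra K (ZMod m)) (c₀ : ZMod m) :
    ∃ j, ‖b.coeff c₀‖ ≤ spectralNorm K L (evalAddChar K (θ.mulShift j) b) := by
  -- Orthogonality leaves only `c = c₀`; the factor `m` is harmless since `|m| = 1`.
  have key : ∑ j, θ (j * -c₀) * evalAddChar K (θ.mulShift j) b =
      algebraMap K L (m * b.coeff c₀) := by
    simp only [evalAddChar_apply, AddChar.mulShift_apply, Finset.mul_sum, mul_smul_comm,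
      ← AddChar.map_add_eq_mul, ← mul_add]
    rw [Finset.sum_comm]
    simp only [← Finset.smul_sum, AddChar.sum_mulShift _ hθ, neg_add_eq_zero, ZMod.card]
    rw [Finset.sum_eq_single c₀ (fun c _ hc => by simp [hc.symm]) (by simp)]
    simp [Algebra.smul_def, mul_comm]
  have hnorm : spectralNorm K L (∑ j, θ (j * -c₀) * evalAddChar K (θ.mulShift j) b) =
      ‖b.coeff c₀‖ := by
    rw [key, spectralNorm_extends, norm_mul, hm, one_mul]
  have hle := isNonarchimedean_spectralNorm (K := K) (L := L) |>.apply_sum_le_sup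
    Finset.univ_nonempty (l := fun j => θ (j * -c₀) * evalAddChar K (θ.mulShift j) b)
  rw [hnorm, Finset.le_sup'_iff] at hle
  obtain ⟨j, -, hj⟩ := hle
  refine ⟨j, hj.trans ((spectralNorm_mul (Algebra.IsAlgebraic.isAlgebraic _)
    (Algebra.IsAlgebraic.isAlgebraic _)).trans_eq ?_)⟩
  rw [spectralNorm_eq_one_of_pow_eq_one (NeZero.pos m), one_mul]
  rw [← AddChar.map_nsmul_eq_pow, nsmul_eq_mul, CharP.cast_eq_zero, zero_mul,
    AddChar.map_zero_eq_one]

end FourierInversion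

/-! ### Lower bound: points from characters of finite quotients. -/

section Points

variable {K : Type*} [NormedField K]

/-- A `K`-algebra homomorphism to an algebraic extension of `K` gives a point of `Max A`, at which
the absolute value is computed by the spectral norm. -/
theorem exists_absAt_eq_spectralNorm {A : Type*} [CommRing A] [Algebra K A] {L : Type*} [Field L]
    [Algebra K L] [Algebra.IsAlgebraic K L] (φ : A →ₐ[K] L) :
    ∃ x : MaximalSpectrum A, ∀ f, absAt K f x = spectralNorm K L (φ f) := by
  have hinj := Ideal.kerLiftAlg_injective φ
  have : (RingHom.ker φ).IsPrime := RingHom.ker_isPrime φ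
  have : Algebra.IsIntegral K (A ⧸ RingHom.ker φ) := Algebra.IsIntegral.of_injective _ hinj
  have hmax : (RingHom.ker φ).IsMaximal := Ideal.Quotient.maximal_of_isField _
    (isField_of_isIntegral_of_isField' (Field.toIsField K))
  refine ⟨⟨RingHom.ker φ, hmax⟩, fun f => ?_⟩
  change spectralValue (minpoly K (Ideal.Quotient.mk (RingHom.ker φ) f)) =
    spectralValue (minpoly K (φ f))
  rw [← minpoly.algHom_eq _ hinj]
  rfl

variable [IsUltrametricDist K]

/-- The group algebra of a finite group is isometric to the space of functions with the supremum
norm. -/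
theorem completeSpace_addMonoidAlgebra [CompleteSpace K] (G : Type*) [AddCommGroup G] [Finite G] :
    CompleteSpace (AddMonoidAlgebra K G) := by
  have := Fintype.ofFinite G
  let e : AddMonoidAlgebra K G →+ (G → K) :=
    { toFun := fun b => b.coeff, map_zero' := rfl, map_add' := fun _ _ => rfl }
  have he : Isometry e := AddMonoidHomClass.isometry_of_norm e fun b => le_antisymm
    ((pi_norm_le_iff_of_nonneg (norm_nonneg b)).mpr (norm_coeff_le b))
    (norm_le_of_forall_coeff (norm_nonneg _) (norm_le_pi_norm (e b)))
  have hs : Function.Surjective e := fun b =>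
    ⟨.ofCoeff (Finsupp.equivFunOnFinite.symm b), rfl⟩
  exact (completeSpace_congr (e := Equiv.ofBijective e ⟨he.injective, hs⟩)
    he.isUniformEmbedding).mpr inferInstance

theorem norm_mapDomain_le {S G : Type*} [AddCommMonoid S] [AddCommMonoid G] (h : S → G)
    (g : AddMonoidAlgebra K S) : ‖AddMonoidAlgebra.mapDomain h g‖ ≤ ‖g‖ := by
  classical
  refine norm_le_of_forall_coeff (norm_nonneg _) fun c => ?_
  rw [AddMonoidAlgebra.coeff_mapDomain, Finsupp.mapDomain, Finsupp.sum, Finsupp.finsetSum_apply]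
  refine IsUltrametricDist.norm_sum_le_of_forall_le_of_nonneg (norm_nonneg _) fun u _ => ?_
  rw [Finsupp.single_apply]
  split_ifs
  · exact norm_coeff_le g u
  · simp

/-- The homomorphism from `K⟨S⟩` to a finite group algebra given by a homomorphism on `S`. -/
theorem exists_algHom_coe_eq_mapDomain [CompleteSpace K] {S G : Type*} [AddCommMonoid S]
    [AddCommGroup G] [Finite G] (h : S →+ G) :
    ∃ ψ : ConvergentAlgebra K S →ₐ[K] AddMonoidAlgebra K G,
      ∀ g : AddMonoidAlgebra K S, ψ g = AddMonoidAlgebra.mapDomain h g := by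
  have := completeSpace_addMonoidAlgebra (K := K) G
  let m : AddMonoidAlgebra K S →ₐ[K] AddMonoidAlgebra K G :=
    AddMonoidAlgebra.mapDomainAlgHom K K h
  have hc : Continuous m := AddMonoidHomClass.continuous_of_bound m 1 fun g => by
    rw [one_mul]; exact norm_mapDomain_le h g
  let ψ := UniformSpace.Completion.extensionHom m.toRingHom hc
  have hψ (g : AddMonoidAlgebra K S) : ψ g = m g :=
    UniformSpace.Completion.extensionHom_coe m.toRingHom hc g
  exact ⟨{ ψ with commutes' := fun k => (hψ (algebraMap K _ k)).trans (m.commutes k) }, hψ⟩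

/-- The Gauss norm of an element of the semigroup algebra is at most its absolute value at some
point whose residue field is algebraic over `K`. -/
theorem exists_norm_le_absAt [CompleteSpace K] {N : Type*} [AddCommGroup N]
    (S : AddSubmonoid (Module.Dual ℤ N)) (g : AddMonoidAlgebra K S) :
    ∃ x : MaximalSpectrum (ConvergentAlgebra K S),
      IsNonarchimedean (fun f => absAt K f x) ∧ ‖g‖ ≤ absAt K (g : ConvergentAlgebra K S) x := by
  classical
  obtain ⟨u₀, hu₀⟩ := exists_norm_coeff_eq g
  obtain ⟨v, hv⟩ := exists_forall_apply_ne_zero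
    ((g.coeff.support.erase u₀).image fun u : S => (u : Module.Dual ℤ N) - (u₀ : Module.Dual ℤ N)) <| by
      simp only [Finset.mem_image, Finset.mem_erase, not_exists, not_and, and_imp, sub_eq_zero]
      exact fun u hu _ h => hu (Subtype.ext h)
  -- A prime above every `|(u - u₀)(v)|` keeps the nonzero differences nonzero modulo `m`.
  obtain ⟨m, hmp, hmB, hm⟩ := exists_prime_norm_eq_one K
    (g.coeff.support.sup fun u => ((u : Module.Dual ℤ N) v - (u₀ : Module.Dual ℤ N) v).natAbs)
  have : NeZero m := ⟨hmp.ne_zero⟩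
  let h : S →+ ZMod m :=
    ((Int.castAddHom (ZMod m)).comp
      (LinearMap.toAddMonoidHom (Module.Dual.eval ℤ N v))).comp S.subtype
  have hsep (u : S) (hu : u ∈ g.coeff.support) (hne : u ≠ u₀) : h u ≠ h u₀ := by
    intro heq
    have h1 : ((((u : Module.Dual ℤ N) v - (u₀ : Module.Dual ℤ N) v : ℤ)) : ZMod m) = 0 := by
      rw [Int.cast_sub, sub_eq_zero]
      exact heq
    have h2 := Int.natAbs_dvd_natAbs.mpr ((ZMod.intCast_zmod_eq_zero_iff_dvd _ _).mp h1)
    have h3 : (u : Module.Dual ℤ N) v - (u₀ : Module.Dual ℤ N) v ≠ 0 :=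
      hv _ (Finset.mem_image_of_mem _ (Finset.mem_erase.mpr ⟨hne, hu⟩))
    refine (Nat.le_of_dvd (Int.natAbs_pos.mpr h3) h2).not_gt ?_
    exact (Finset.le_sup (f := fun u : S =>
      ((u : Module.Dual ℤ N) v - (u₀ : Module.Dual ℤ N) v).natAbs) hu).trans_lt hmB
  have hcoeff : (AddMonoidAlgebra.mapDomain h g).coeff (h u₀) = g.coeff u₀ := by
    rw [AddMonoidAlgebra.coeff_mapDomain, Finsupp.mapDomain, Finsupp.sum, Finsupp.finsetSum_apply,
      Finset.sum_eq_single u₀]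
    · simp
    · intro u hu hne
      rw [Finsupp.single_apply, if_neg (hsep u hu hne)]
    · intro hu
      rw [Finsupp.notMem_support_iff.mp hu]
      simp
  have : NeZero (m : AlgebraicClosure K) := ⟨by
    rw [← map_natCast (algebraMap K (AlgebraicClosure K))]
    exact (map_ne_zero _).mpr (norm_ne_zero_iff.mp (by rw [hm]; exact one_ne_zero))⟩
  obtain ⟨ζ, hζ⟩ := HasEnoughRootsOfUnity.exists_primitiveRoot (AlgebraicClosure K) m
  obtain ⟨j, hj⟩ := exists_norm_coeff_le_spectralNorm_evalAddChar hm
    (AddChar.zmodChar_primitive_of_primitive_root m hζ) (AddMonoidAlgebra.mapDomain h g) (h u₀)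
  obtain ⟨ψ, hψ⟩ := exists_algHom_coe_eq_mapDomain (K := K) h
  obtain ⟨x, hx⟩ := exists_absAt_eq_spectralNorm
    ((evalAddChar K ((AddChar.zmodChar m hζ.pow_eq_one).mulShift j)).comp ψ)
  refine ⟨x, fun a b => ?_, ?_⟩
  · simp only [hx, map_add]
    exact isNonarchimedean_spectralNorm _ _
  rw [hx, ← hu₀, ← hcoeff, AlgHom.comp_apply, hψ]
  exact hj

theorem exists_absAt_eq_norm [CompleteSpace K] {N : Type*} [AddCommGroup N]
    (S : AddSubmonoid (Module.Dual ℤ N)) (f : ConvergentAlgebra K S) :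
    ∃ x : MaximalSpectrum (ConvergentAlgebra K S), absAt K f x = ‖f‖ := by
  rcases eq_or_ne f 0 with rfl | hf
  -- For `f = 0` only the existence of a point is needed.
  · obtain ⟨x, -, hx⟩ := exists_norm_le_absAt (K := K) S 0
    rw [UniformSpace.Completion.coe_zero, norm_zero] at hx
    exact ⟨x, le_antisymm (absAt_le_norm 0 x) (by rwa [norm_zero])⟩
  obtain ⟨g, hg⟩ := exists_norm_sub_coe_lt f (norm_pos_iff.mpr hf)
  have hfg : ‖f‖ = ‖(g : ConvergentAlgebra K S)‖ := norm_eq_of_norm_sub_lt_left hg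
  obtain ⟨x, hadd, hx⟩ := exists_norm_le_absAt S g
  rw [← UniformSpace.Completion.norm_coe, ← hfg] at hx
  refine ⟨x, le_antisymm (absAt_le_norm f x) ?_⟩
  -- `|g(x)| ≤ max(|f(x)|, |(g - f)(x)|)`, and the second entry is below `‖f‖`.
  have h1 := hadd f (g - f)
  simp only [add_sub_cancel] at h1
  have h2 := (absAt_le_norm (K := K) ((g : ConvergentAlgebra K S) - f) x).trans_lt
    (by rwa [norm_sub_rev])
  exact (le_max_iff.mp (hx.trans h1)).resolve_right h2.not_ge

end Points

end ToricRigid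

end

theorem lemma2 {K : Type*} [NormedField K] [IsUltrametricDist K] [CompleteSpace K]
    {N : Type*} [AddCommGroup N] [Module.Free ℤ N] [Module.Finite ℤ N]
    (σ : PointedCone ℝ (ℝ ⊗[ℤ] N)) (hσ : ToricRigid.IsStronglyConvexRationalPolyhedral σ)
    (f : ToricRigid.ConvergentAlgebra K (ToricRigid.semigroup σ)) :
    (∃! a : ToricRigid.semigroup σ → K, ToricRigid.IsExpansion a f) ∧
    ∀ a : ToricRigid.semigroup σ → K, ToricRigid.IsExpansion a f →
      IsLUB (Set.range fun x => ToricRigid.absAt K f x) (ToricRigid.supSeminorm K f) ∧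
      IsGreatest (Set.range fun u => ‖a u‖) (ToricRigid.supSeminorm K f) := by
  refine ⟨ToricRigid.existsUnique_isExpansion f, fun a ha => ?_⟩
  obtain ⟨x, hx⟩ := ToricRigid.exists_absAt_eq_norm (ToricRigid.semigroup σ) f
  have hmax : IsGreatest (Set.range fun x => ToricRigid.absAt K f x) ‖f‖ :=
    ⟨⟨x, hx⟩, by rintro - ⟨y, rfl⟩; exact ToricRigid.absAt_le_norm f y⟩
  have hsup : ToricRigid.supSeminorm K f = ‖f‖ := hmax.csSup_eq
  rw [hsup, ha.eq_coeffL]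
  exact ⟨hmax.isLUB, ToricRigid.isGreatest_norm_coeffL f⟩
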